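/- A configuration is a function $c:\mathbb{Z}^2\to\mathbb{Z}$ that takes only finitely many values, identified with the formal power series $\sum_{(i,j)\in\mathbb{Z}^2} c_{i,j}\,x^iy^j$. A non-trivial annihilator of $c$ is a non-zero Laurent polynomial $f\in\mathbb{Z}[x^{\pm1},y^{\pm1}]$ such that the formal product $fc$ is the zero power series. The orbit closure $\overline{\mathcal{O}(c)}$ is the closure of the set of all translates $\tau^{\vec t}(c)$, $\vec t\in\mathbb{Z}^2$, where $\tau^{\vec t}(c)_{\vec n}=c_{\vec n-\vec t}$, in the product of the discrete topologies. For a non-zero $\vec u\in\mathbb{Z}^2$ let $H_{\vec u}=\{\vec x\in\mathbb{Z}^2 : \langle\vec x,\vec u\rangle<0\}$. A set $X$ of configurations is deterministic in direction $\vec u$ if for all $e,e'\in X$, $e|_{H_{\vec u}}=e'|_{H_{\vec u}}$ implies $e=e'$. If $X$ is deterministic in both directions $\vec u$ and $-\vec u$, then $\vec u$ is a direction of two-sided determinism of $X$; if $X$ is deterministic in direction $\vec u$ but not in direction $-\vec u$, then $\vec u$ is a direction of one-sided determinism of $X$. **Proposition.** Let $c$ be a configuration that has a non-trivial annihilator.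 If $\vec u\in\mathbb{Z}^2\setminus\{\vec 0\}$ is a direction of one-sided determinism of $\overline{\mathcal{O}(c)}$, then there is a configuration $d\in\overline{\mathcal{O}(c)}$ such that $\vec u$ is a direction of two-sided determinism of $\overline{\mathcal{O}(d)}$. -/

import Mathlib

/-- Configurations with integer colors, identified with formal power series
`∑ c (i, j) x^i y^j` with exponents in `ℤ`. That only finitely many colors occur (`IsFinitary`)
is a separate condition. -/
abbrev Config : Type := ℤ × ℤ → ℤ

/-- Laurent polynomials in two variables over `ℤ`; the exponent of a monomial is in `ℤ × ℤ`. -/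
abbrev LaurentPoly₂ : Type := AddMonoidAlgebra ℤ (ℤ × ℤ)

namespace Config

/-- Only finitely many colors occur. -/
def IsFinitary (c : Config) : Prop := (Set.range c).Finite

/-- The translation `τ^t`. -/
def translate (t : ℤ × ℤ) (c : Config) : Config := fun n => c (n - t)

/-- The formal product `f c` of a Laurent polynomial and a power series:
the coefficient at `n` is `∑ a, f_a * c (n - a)`. -/
def formalMul (f : LaurentPoly₂) (c : Config) : Config :=
  fun n => ∑ a ∈ f.coeff.support, f.coeff a * c (n - a)

/-- The set of Laurent polynomials that annihilate `c`. -/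
def Ann (c : Config) : Set LaurentPoly₂ := {f | formalMul f c = 0}

/-- Some non-zero Laurent polynomial annihilates `c`. -/
def HasNontrivialAnnihilator (c : Config) : Prop := ∃ f ∈ Ann c, f ≠ 0

/-- The set of all translates of `c`. -/
def orbit (c : Config) : Set Config := Set.range fun t => translate t c

/-- The closure of the orbit in the product topology, `ℤ` being discrete. -/
def orbitClosure (c : Config) : Set Config := closure (orbit c)

end Config

/-- The inner product of integer vectors. -/
def latticeInner (x y : ℤ × ℤ) : ℤ := x.1 * y.1 + x.2 * y.2

/-- The discrete half plane in direction `u`. -/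
def discreteHalfPlane (u : ℤ × ℤ) : Set (ℤ × ℤ) := {x | latticeInner x u < 0}

/-- `X` is deterministic in direction `u`: the contents of the half plane in direction `u`
determine an element of `X`. -/
def IsDeterministic (X : Set Config) (u : ℤ × ℤ) : Prop :=
  ∀ c ∈ X, ∀ c' ∈ X, Set.EqOn c c' (discreteHalfPlane u) → c = c'

/-- The direction `u` is one of two-sided determinism of `X`. -/
def IsTwoSidedDeterministic (X : Set Config) (u : ℤ × ℤ) : Prop :=
  IsDeterministic X u ∧ IsDeterministic X (-u)

/-- The direction `u` is one of one-sided determinism of `X`. -/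
def IsOneSidedDeterministic (X : Set Config) (u : ℤ × ℤ) : Prop :=
  IsDeterministic X u ∧ ¬ IsDeterministic X (-u)

/-! Let `Z` be a minimal subshift in the orbit closure of `c`; it inherits determinism in direction
`u`, and any `d ∈ Z` works once `Z` is shown to be deterministic in direction `-u`. Put `ℓ = ⟨·, u⟩`
and let `v` generate its kernel.

If `e, e' ∈ Z` agree on `0 < ℓ`, their difference is bounded and annihilated by `f`, which makes it
periodic along `v` with a period `p` independent of the pair (`exists_period_of_vanish`). Modulo
this period a strip is a finite block, so by determinism a finite block determines everything above
it among configurations differing by such a periodic one (`exists_block_of_deterministic`).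

Fix `e` and count the blocks shown by its fibre, the configurations of `Z` that differ from `e` by a
periodic one. Far down, the blocks separate the fibre, which is therefore finite. If `e ≠ e'` agree
on `0 < ℓ`, then high up their blocks coincide and the count is smaller. The set of blocks is upper
semicontinuous, and by minimality the orbit of `e` returns near the high position from arbitrarily
far down: a contradiction (`eq_of_eqOn_of_minimal`). -/

open Set Filter Topology

/-! ### Bounded solutions of linear recurrences -/

/-- A solution of a linear recurrence on `ℤ` that vanishes on a long enough window is zero. -/
theorem eq_zero_of_recurrence {α : Type*} {T : Finset α} {ι : α → ℤ} {q : α → ℤ}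
    (hι : Set.InjOn ι T) (hq : ∀ a ∈ T, q a ≠ 0) {a b : α} (ha : a ∈ T) (hb : b ∈ T)
    (hmin : ∀ i ∈ T, ι a ≤ ι i) (hmax : ∀ i ∈ T, ι i ≤ ι b)
    {s : ℤ → ℤ} (hs : ∀ n, ∑ i ∈ T, q i * s (n - ι i) = 0) {m : ℤ}
    (hw : ∀ j, m ≤ j → j < m + (ι b - ι a) → s j = 0) (j : ℤ) : s j = 0 := by
  -- In the equation at `j + ι a` every term but that of `a` lies at a position below `j` that is
  -- already known to vanish; `hdown` is the mirror image with `b`.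
  have hup : ∀ n : ℕ, ∀ j, m ≤ j → j < m + (ι b - ι a) + n → s j = 0 := by
    intro n
    induction n with
    | zero => intro j h1 h2; exact hw j h1 (by simpa using h2)
    | succ n ih =>
      intro j h1 h2
      by_cases h3 : j < m + (ι b - ι a) + n
      · exact ih j h1 h3
      have h := hs (j + ι a)
      rw [Finset.sum_eq_single_of_mem a ha] at h
      · simpa [hq a ha] using h
      · intro i hi hia
        have h4 := hmin i hi
        have h5 : ι a ≠ ι i := fun h => hia (hι hi ha h.symm)
        have h6 := hmax i hi
        rw [ih _ (by push_cast at h2; omega) (by push_cast at h2; omega), mul_zero]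
  have hdown : ∀ n : ℕ, ∀ j, m - n ≤ j → s j = 0 := by
    intro n
    induction n with
    | zero =>
      intro j h1
      exact hup (j - m + 1).toNat j (by simpa using h1) (by
        have := hmin b hb
        push_cast at h1; omega)
    | succ n ih =>
      intro j h1
      by_cases h3 : m - n ≤ j
      · exact ih j h3
      have h := hs (j + ι b)
      rw [Finset.sum_eq_single_of_mem b hb] at h
      · simpa [hq b hb] using h
      · intro i hi hib
        have h4 := hmax i hi
        have h5 : ι b ≠ ι i := fun h => hib (hι hi hb h.symm)
        rw [ih _ (by push_cast at h1; omega), mul_zero]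
  exact hdown (m - j).toNat j (by omega)

/-- The solutions of a linear recurrence on `ℤ` that are bounded by `M` have a common period. -/
theorem exists_period_of_recurrence {α : Type*} {T : Finset α} (hT : T.Nonempty) {ι : α → ℤ}
    {q : α → ℤ} (hι : Set.InjOn ι T) (hq : ∀ a ∈ T, q a ≠ 0) (M : ℤ) :
    ∃ p : ℕ, 0 < p ∧ ∀ s : ℤ → ℤ, (∀ n, |s n| ≤ M) →
      (∀ n, ∑ i ∈ T, q i * s (n - ι i) = 0) → ∀ n, s (n + p) = s n := by
  obtain ⟨a, ha, hmin⟩ := T.exists_min_image ι hT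
  obtain ⟨b, hb, hmax⟩ := T.exists_max_image ι hT
  let D := (ι b - ι a).toNat
  let K := Fin D → Set.Icc (-M) M
  let N := Fintype.card K
  -- There are `N` possible windows of length `D`, so two of `N + 1` consecutive ones agree. Their
  -- distance is then a period of `s`; it is at most `N`, hence divides `N!`, which does not depend
  -- on `s`.
  refine ⟨N.factorial, N.factorial_pos, fun s hM hs => ?_⟩
  let S : Fin (N + 1) → K := fun n j => ⟨s (n + j), abs_le.mp (hM _)⟩
  obtain ⟨x, y, hxy, hS⟩ := Fintype.exists_ne_map_eq_of_card_lt S (by simp [N])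
  wlog hlt : x < y generalizing x y
  · exact this y x hxy.symm hS.symm (lt_of_le_of_ne (not_lt.mp hlt) hxy.symm)
  have hper : ∀ n, s (n + ((y : ℕ) - (x : ℕ) : ℤ)) - s n = 0 := by
    refine eq_zero_of_recurrence (m := (x : ℕ)) hι hq ha hb hmin hmax
      (s := fun n => s (n + ((y : ℕ) - (x : ℕ) : ℤ)) - s n) ?_ ?_
    · intro n
      have h1 := hs (n + ((y : ℕ) - (x : ℕ) : ℤ))
      have h2 := hs n
      simp only [mul_sub, Finset.sum_sub_distrib, h2, sub_zero]
      rw [← h1]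
      exact Finset.sum_congr rfl fun i _ => by congr 2; ring
    · intro j h1 h2
      have h := congrFun hS ⟨(j - (x : ℕ)).toNat, by simp only [D]; omega⟩
      have h' : s ((x : ℕ) + ((j - (x : ℕ)).toNat : ℤ)) = s ((y : ℕ) + ((j - (x : ℕ)).toNat : ℤ)) :=
        congrArg Subtype.val h
      rw [Int.toNat_of_nonneg (by omega)] at h'
      have e1 : ((x : ℕ) + (j - (x : ℕ)) : ℤ) = j := by ring
      have e2 : ((y : ℕ) + (j - (x : ℕ)) : ℤ) = j + ((y : ℕ) - (x : ℕ) : ℤ) := by ring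
      rw [e1, e2] at h'
      rw [h', sub_self]
  have hlt' : (x : ℕ) < y := hlt
  obtain ⟨k, hk⟩ : (y : ℕ) - (x : ℕ) ∣ N.factorial :=
    Nat.dvd_factorial (by omega) (by have := y.2; omega)
  have hmul : ∀ k : ℕ, ∀ n, s (n + k * ((y : ℕ) - (x : ℕ) : ℤ)) = s n := by
    intro k
    induction k with
    | zero => intro n; simp
    | succ k ih =>
      intro n
      rw [← ih n, ← sub_eq_zero, ← hper (n + k * ((y : ℕ) - (x : ℕ) : ℤ))]
      congr 2
      push_cast; ring
  intro n
  rw [hk, ← hmul k n]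
  congr 2
  push_cast [Nat.cast_sub hlt'.le]; ring

/-! ### Periodicity of one-sided solutions -/

/-- Bounded configurations that are annihilated by `f` and vanish on the half plane `0 < ℓ`
are periodic along the boundary of the half plane, with a common period. -/
theorem exists_period_of_vanish (ℓ : ℤ × ℤ →+ ℤ) {v : ℤ × ℤ} (hv : ℓ v = 0)
    (hker : ∀ x, ℓ x = 0 → ∃ i : ℤ, x = i • v) {f : LaurentPoly₂} (hf : f ≠ 0) (M : ℤ) :
    ∃ p : ℕ, 0 < p ∧ ∀ δ : Config, (∀ x, |δ x| ≤ M) → Config.formalMul f δ = 0 →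
      (∀ x, 0 < ℓ x → δ x = 0) → ∀ x, δ (x + (p : ℤ) • v) = δ x := by
  have hne : f.coeff.support.Nonempty := by
    rw [Finsupp.support_nonempty_iff]
    intro h
    exact hf (by ext x; simp [h])
  obtain ⟨a₀, ha₀, hmax⟩ := f.coeff.support.exists_max_image ℓ hne
  -- The edge of `f` on which `ℓ` is maximal: it gives the recurrence along a row above which
  -- everything vanishes.
  let T := f.coeff.support.filter fun a => ℓ a = ℓ a₀
  have hidx : ∀ a, ∃ i : ℤ, ℓ a = ℓ a₀ → a = a₀ + i • v := by
    intro a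
    by_cases h : ℓ a = ℓ a₀
    · obtain ⟨i, hi⟩ := hker (a - a₀) (by simp [h])
      exact ⟨i, fun _ => by rw [← hi]; abel⟩
    · exact ⟨0, fun h' => absurd h' h⟩
  choose ι hι using hidx
  have hmemT : ∀ a, a ∈ T ↔ a ∈ f.coeff.support ∧ ℓ a = ℓ a₀ := fun a => by simp [T]
  obtain ⟨p, hp, hper⟩ := exists_period_of_recurrence (T := T) (ι := ι) (q := f.coeff)
    ⟨a₀, (hmemT _).2 ⟨ha₀, rfl⟩⟩
    (fun a ha b hb h => by
      rw [hι a ((hmemT a).1 ha).2, hι b ((hmemT b).1 hb).2, h])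
    (fun a ha => Finsupp.mem_support_iff.1 ((hmemT a).1 ha).1) (2 * M)
  refine ⟨p, hp, fun δ hM hann hzero => ?_⟩
  have hℓv : ∀ (x : ℤ × ℤ) (i : ℤ), ℓ (x + i • v) = ℓ x := fun x i => by
    rw [map_add, map_zsmul, hv, smul_zero, add_zero]
  set ε : Config := fun x => δ (x + (p : ℤ) • v) - δ x with hε
  have hεann : ∀ n, ∑ a ∈ f.coeff.support, f.coeff a * ε (n - a) = 0 := by
    intro n
    have h1 := congrFun hann n
    have h2 := congrFun hann (n + (p : ℤ) • v)
    simp only [Config.formalMul, Pi.zero_apply] at h1 h2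
    simp only [hε, mul_sub, Finset.sum_sub_distrib, h1, sub_zero]
    rw [← h2]
    exact Finset.sum_congr rfl fun a _ => by congr 2; abel
  -- Row by row downwards: once `ε` vanishes above a row, its restriction to that row solves the
  -- edge recurrence and so has period `p`.
  have hmain : ∀ n : ℕ, ∀ x, 1 - (n : ℤ) ≤ ℓ x → ε x = 0 := by
    intro n
    induction n with
    | zero =>
      intro x hx
      simp only [hε]
      rw [hzero x (by push_cast at hx; omega),
        hzero _ (by rw [hℓv]; push_cast at hx; omega), sub_zero]
    | succ n ih =>
      intro x hx
      by_cases hx' : 1 - (n : ℤ) ≤ ℓ x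
      · exact ih x hx'
      have hs := hper (fun i => ε (x + i • v))
        (fun i => (abs_sub _ _).trans (by linarith [hM (x + i • v + (p : ℤ) • v), hM (x + i • v)]))
        (fun i => by
          rw [← hεann (x + i • v + a₀)]
          symm
          rw [← Finset.sum_subset (Finset.filter_subset (fun a => ℓ a = ℓ a₀) _)]
          · refine Finset.sum_congr rfl fun a ha => ?_
            have h := hι a ((hmemT a).1 ha).2
            have e : x + i • v + a₀ - a = x + (i - ι a) • v := by
              nth_rewrite 1 [h]
              rw [sub_smul]; abel
            rw [e]
          · intro a ha haT
            have h1 := hmax a ha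
            have h2 : ℓ a ≠ ℓ a₀ := fun h => haT (by simp only [Finset.mem_filter]; exact ⟨ha, h⟩)
            rw [ih _ (by
              rw [map_sub, map_add, hℓv]
              push_cast at hx
              omega), mul_zero])
      -- Since `ε` is the increment of `δ` over `p • v`, periodicity of `ε` makes `δ` grow linearly,
      -- which boundedness forbids unless `ε x = 0`.
      have hlin : ∀ k : ℕ, δ (x + ((k * p : ℕ) : ℤ) • v) = δ x + k * ε x := by
        have hεk : ∀ k : ℕ, ε (x + ((k * p : ℕ) : ℤ) • v) = ε x := by
          intro k
          induction k with
          | zero => simp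
          | succ k ihk =>
            have e : (((k + 1) * p : ℕ) : ℤ) = ((k * p : ℕ) : ℤ) + p := by push_cast; ring
            rw [e, hs, ihk]
        intro k
        induction k with
        | zero => simp
        | succ k ihk =>
          have h := hεk k
          simp only [hε] at h ⊢
          have e : x + (((k + 1) * p : ℕ) : ℤ) • v = x + ((k * p : ℕ) : ℤ) • v + (p : ℤ) • v := by
            rw [add_assoc, ← add_smul]; congr 2; push_cast; ring
          rw [e]
          push_cast
          simp only [hε] at ihk
          push_cast at ihk h
          linarith
      by_contra hne0
      have hM0 : 0 ≤ M := (abs_nonneg _).trans (hM x)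
      -- Two values of `δ` differ by at most `2 * M`, while `2 * M + 1` non-zero integer increments
      -- exceed this.
      have hk := hlin (2 * M + 1).toNat
      have h1 := abs_le.1 (hM (x + (((2 * M + 1).toNat * p : ℕ) : ℤ) • v))
      have h2 := abs_le.1 (hM x)
      rw [hk, Int.toNat_of_nonneg (by omega)] at h1
      rcases lt_or_gt_of_ne hne0 with h | h
      · nlinarith
      · nlinarith
  intro x
  have := hmain (1 - ℓ x).toNat x (by omega)
  exact sub_eq_zero.1 this

/-! ### Subshifts -/

namespace Config

theorem continuous_translate (t : ℤ × ℤ) : Continuous (translate t) :=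
  continuous_pi fun n => continuous_apply (n - t)

theorem translate_translate (s t : ℤ × ℤ) (e : Config) :
    translate s (translate t e) = translate (s + t) e := by
  funext n
  simp only [translate]
  congr 1; abel

/-- Closed sets of configurations that are invariant under translations. -/
structure IsSubshift (Z : Set Config) : Prop where
  isClosed : IsClosed Z
  translate_mem : ∀ t, ∀ e ∈ Z, translate t e ∈ Z

theorem isSubshift_orbitClosure (c : Config) : IsSubshift c.orbitClosure where
  isClosed := isClosed_closure
  translate_mem t e he := by
    refine map_mem_closure (continuous_translate t) he ?_
    rintro _ ⟨s, rfl⟩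
    exact ⟨t + s, (translate_translate t s c).symm⟩

theorem mem_orbitClosure_self (c : Config) : c ∈ c.orbitClosure :=
  subset_closure ⟨0, by funext n; simp [translate]⟩

theorem IsSubshift.orbitClosure_subset {Z : Set Config} (hZ : IsSubshift Z) {d : Config}
    (hd : d ∈ Z) : d.orbitClosure ⊆ Z :=
  closure_minimal (by rintro _ ⟨t, rfl⟩; exact hZ.translate_mem t d hd) hZ.isClosed

/-- Every non-empty compact subshift contains a minimal one. -/
theorem IsSubshift.exists_minimal {X : Set Config} (hX : IsSubshift X) (hc : IsCompact X)
    (hne : X.Nonempty) :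
    ∃ Z ⊆ X, Minimal (fun Z => IsSubshift Z ∧ Z.Nonempty) Z := by
  have hz := zorn_superset_nonempty {Z | (IsSubshift Z ∧ Z.Nonempty) ∧ Z ⊆ X} (by
    intro C hC hchain hCne
    refine ⟨⋂₀ C, ⟨⟨⟨isClosed_sInter fun Z hZ => (hC hZ).1.1.isClosed, fun t e he Z hZ =>
      (hC hZ).1.1.translate_mem t e (he Z hZ)⟩, ?_⟩, ?_⟩, fun Z hZ => sInter_subset_of_mem hZ⟩
    · have := hCne.to_subtype
      rw [sInter_eq_iInter]
      refine IsCompact.nonempty_iInter_of_directed_nonempty_isCompact_isClosed _ ?_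
        (fun Z => (hC Z.2).1.2) (fun Z => hc.of_isClosed_subset (hC Z.2).1.1.isClosed (hC Z.2).2)
        (fun Z => (hC Z.2).1.1.isClosed)
      intro Z Z'
      rcases hchain.total Z.2 Z'.2 with h | h
      · exact ⟨Z, Subset.rfl, h⟩
      · exact ⟨Z', h, Subset.rfl⟩
    · obtain ⟨Z, hZ⟩ := hCne
      exact (sInter_subset_of_mem hZ).trans (hC hZ).2) X ⟨⟨hX, hne⟩, Subset.rfl⟩
  obtain ⟨Z, hZX, hZ⟩ := hz
  refine ⟨Z, hZX, hZ.prop.1, fun Z' hZ' hle => hZ.le_of_le ⟨hZ', hle.trans hZX⟩ hle⟩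

/-- In a minimal subshift every orbit visits every open set arbitrarily far in any direction. -/
theorem exists_translate_mem_of_minimal {Z : Set Config} (hc : IsCompact Z)
    (hmin : Minimal (fun Z => IsSubshift Z ∧ Z.Nonempty) Z) (ℓ : ℤ × ℤ →+ ℤ)
    (hℓ : ∀ N : ℤ, ∃ t, N ≤ ℓ t) {e : Config} (he : e ∈ Z) {O : Set Config} (hO : IsOpen O)
    (hOZ : (O ∩ Z).Nonempty) (N : ℤ) : ∃ t, N ≤ ℓ t ∧ translate t e ∈ O := by
  have hZ := hmin.prop.1
  -- The intersection of the `L N` is the limit set of the orbit of `e` in the direction of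
  -- increasing `ℓ`. It is a non-empty subshift, hence all of `Z`.
  let L : ℕ → Set Config := fun N => closure ((translate · e) '' {t | (N : ℤ) ≤ ℓ t})
  have hLZ : ∀ N, L N ⊆ Z := fun N => closure_minimal
    (by rintro _ ⟨t, -, rfl⟩; exact hZ.translate_mem t e he) hZ.isClosed
  have hsub : IsSubshift (⋂ N, L N) := by
    refine ⟨isClosed_iInter fun N => isClosed_closure, fun s z hz => mem_iInter.2 fun N => ?_⟩
    have hz' := mem_iInter.1 hz (N - ℓ s).toNat
    refine map_mem_closure (continuous_translate s) hz' ?_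
    rintro _ ⟨t, ht, rfl⟩
    refine ⟨s + t, ?_, (translate_translate s t e).symm⟩
    simp only [mem_ofPred_eq, map_add] at ht ⊢
    omega
  have hne : (⋂ N, L N).Nonempty := by
    refine IsCompact.nonempty_iInter_of_sequence_nonempty_isCompact_isClosed L ?_ ?_
      (hc.of_isClosed_subset isClosed_closure (hLZ 0)) (fun N => isClosed_closure)
    · intro N
      refine closure_mono (image_mono fun t ht => ?_)
      simp only [mem_ofPred_eq] at ht ⊢
      push_cast at ht
      omega
    · intro N
      obtain ⟨t, ht⟩ := hℓ N
      exact ⟨_, subset_closure ⟨t, ht, rfl⟩⟩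
  have hle : Z ⊆ ⋂ N, L N := hmin.le_of_le ⟨hsub, hne⟩ ((iInter_subset _ 0).trans (hLZ 0))
  obtain ⟨z, hzO, hzZ⟩ := hOZ
  obtain ⟨_, hxO, t, ht, rfl⟩ := mem_closure_iff.1 (mem_iInter.1 (hle hzZ) N.toNat) O hO hzO
  simp only [mem_ofPred_eq] at ht
  exact ⟨t, by omega, hxO⟩

/-- A finite part of the half plane determines the next symbol. -/
theorem exists_finset_of_deterministic {X : Set Config} (hc : IsCompact X) {H : Set (ℤ × ℤ)}
    (hdet : ∀ e ∈ X, ∀ e' ∈ X, EqOn e e' H → e = e') :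
    ∃ D : Finset (ℤ × ℤ), ↑D ⊆ H ∧ ∀ e ∈ X, ∀ e' ∈ X, EqOn e e' D → e 0 = e' 0 := by
  have hne : ∀ x : ℤ × ℤ, IsClopen {z : Config × Config | z.1 x ≠ z.2 x} := fun x =>
    (isClopen_discrete {z : ℤ × ℤ | z.1 ≠ z.2}).preimage
      (f := fun z : Config × Config => (z.1 x, z.2 x)) (by fun_prop)
  -- The pairs that differ at `0` form a compact set, covered by the open conditions of differing at
  -- some `x ∈ H`.
  obtain ⟨D, hD⟩ := ((hc.prod hc).inter_right (hne 0).isClosed).elim_finite_subcover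
    (fun x : H => {z : Config × Config | z.1 x ≠ z.2 x}) (fun x => (hne x).isOpen) (by
      rintro ⟨e, e'⟩ ⟨⟨he, he'⟩, h0⟩
      by_contra hcon
      simp only [mem_iUnion, mem_ofPred_eq, not_exists, not_not] at hcon
      exact h0 (congrFun (hdet e he e' he' fun x hx => hcon ⟨x, hx⟩) 0))
  refine ⟨D.image Subtype.val, by simp, fun e he e' he' h => ?_⟩
  by_contra h0
  obtain ⟨x, hx, hxne⟩ := mem_iUnion₂.1 (hD (show (e, e') ∈ _ from ⟨⟨he, he'⟩, h0⟩))
  exact hxne (h (by simpa using hx))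

/-! ### Fibres of configurations with periodic differences. -/

/-- Two configurations whose difference has period `w`. -/
def PeriodicDiff (w : ℤ × ℤ) (e e' : Config) : Prop := ∀ x, e (x + w) - e' (x + w) = e x - e' x

theorem PeriodicDiff.translate {w : ℤ × ℤ} {e e' : Config} (h : PeriodicDiff w e e') (t : ℤ × ℤ) :
    PeriodicDiff w (translate t e) (translate t e') := fun x => by
  have := h (x - t)
  rwa [sub_add_eq_add_sub] at this

theorem PeriodicDiff.zsmul {w : ℤ × ℤ} {e e' : Config} (h : PeriodicDiff w e e') (i : ℤ)
    (x : ℤ × ℤ) : e (x + i • w) - e' (x + i • w) = e x - e' x := by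
  induction i using Int.induction_on with
  | zero => simp
  | succ i ih => rw [← ih, add_smul, one_smul, ← add_assoc]; exact h _
  | pred i ih =>
    rw [← ih, ← h, sub_smul, one_smul]
    congr 2 <;> abel_nf

theorem PeriodicDiff.symm {w : ℤ × ℤ} {e e' : Config} (h : PeriodicDiff w e e') :
    PeriodicDiff w e' e := fun x => by linarith [h x]

theorem PeriodicDiff.trans {w : ℤ × ℤ} {e e' e'' : Config} (h : PeriodicDiff w e e')
    (h' : PeriodicDiff w e' e'') : PeriodicDiff w e e'' := fun x => by linarith [h x, h' x]

/-- In a subshift that is deterministic in the direction of the half plane `ℓ < 0`, a finite block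
determines, among configurations that differ by a periodic one, everything above the block. -/
theorem exists_block_of_deterministic {X : Set Config} (hX : IsSubshift X) (hc : IsCompact X)
    (ℓ : ℤ × ℤ →+ ℤ) {v : ℤ × ℤ} (hv : ℓ v = 0) (hker : ∀ x, ℓ x = 0 → ∃ i : ℤ, x = i • v)
    (hdet : ∀ e ∈ X, ∀ e' ∈ X, EqOn e e' {x | ℓ x < 0} → e = e') {p : ℕ} (hp : 0 < p) :
    ∃ (B : Finset (ℤ × ℤ)) (k : ℕ), (∀ x ∈ B, -(k : ℤ) ≤ ℓ x) ∧ ∀ e ∈ X, ∀ e' ∈ X,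
      PeriodicDiff ((p : ℤ) • v) e e' → EqOn e e' B → ∀ x, -(k : ℤ) ≤ ℓ x → e x = e' x := by
  obtain ⟨D, hDH, hD⟩ := exists_finset_of_deterministic hc hdet
  obtain ⟨k, hk⟩ : ∃ k : ℕ, ∀ x ∈ D, -(k : ℤ) ≤ ℓ x :=
    ⟨D.sup fun x => (ℓ x).natAbs, fun x hx => by
      have := Finset.le_sup (f := fun x => (ℓ x).natAbs) hx
      omega⟩
  let ξ := Function.invFun ℓ
  have hξ : ∀ x, ℓ (ξ (ℓ x)) = ℓ x := fun x => Function.invFun_eq ⟨x, rfl⟩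
  -- A fundamental domain, modulo `p • v`, of the strip `-k ≤ ℓ < 0`. As `ℓ` need not be surjective,
  -- `ξ` may take arbitrary values off its range; the filter discards points that are too low.
  let B := ((Finset.Ico (-(k : ℤ)) 0 ×ˢ Finset.Ico (0 : ℤ) p).image
    fun z => ξ z.1 + z.2 • v).filter fun x => -(k : ℤ) ≤ ℓ x
  refine ⟨B, k, fun x hx => (Finset.mem_filter.1 hx).2, fun e he e' he' hper hB => ?_⟩
  have hstrip : ∀ x, -(k : ℤ) ≤ ℓ x → ℓ x < 0 → e x = e' x := by
    intro x h1 h2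
    obtain ⟨j, hj⟩ := hker (x - ξ (ℓ x)) (by simp [hξ])
    have hx : x = (ξ (ℓ x) + (j % p) • v) + (j / p) • ((p : ℤ) • v) := by
      rw [add_assoc, smul_smul, ← add_smul, mul_comm, Int.emod_add_mul_ediv, ← hj]
      abel
    have h3 := hper.zsmul (j / p) (ξ (ℓ x) + (j % p) • v)
    rw [← hx] at h3
    have hp' : (0 : ℤ) < p := by exact_mod_cast hp
    have h4 : e (ξ (ℓ x) + (j % p) • v) = e' (ξ (ℓ x) + (j % p) • v) := by
      refine hB (Finset.mem_coe.2 (Finset.mem_filter.2 ⟨Finset.mem_image.2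
        ⟨(ℓ x, j % p), ?_, rfl⟩, by
          rw [map_add, map_zsmul, hv, smul_zero, add_zero, hξ]; exact h1⟩))
      simp [h1, h2, Int.emod_nonneg j hp'.ne', Int.emod_lt_of_pos j hp']
    linarith
  have hup : ∀ n : ℕ, ∀ x, -(k : ℤ) ≤ ℓ x → ℓ x < n → e x = e' x := by
    intro n
    induction n with
    | zero => intro x h1 h2; exact hstrip x h1 (by simpa using h2)
    | succ n ih =>
      intro x h1 h2
      by_cases h3 : ℓ x < n
      · exact ih x h1 h3
      have h := hD _ (hX.translate_mem (-x) e he) _ (hX.translate_mem (-x) e' he') (by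
        intro y hy
        have h4 := hk y hy
        have h5 : ℓ y < 0 := hDH hy
        push_cast at h2
        exact ih _ (by simp; omega) (by simp; omega))
      simpa [translate] using h
  exact fun x hx => hup (ℓ x + 1).toNat x hx (by omega)

/-- If configurations of a subshift that agree on `0 < ℓ` differ by a periodic one, then
determinism in one direction gives determinism in the other on minimal subshifts. -/
theorem eq_of_eqOn_of_minimal {Z : Set Config} (hc : IsCompact Z)
    (hmin : Minimal (fun Z => IsSubshift Z ∧ Z.Nonempty) Z) {M : ℤ}
    (hM : ∀ e ∈ Z, ∀ x, |e x| ≤ M) (ℓ : ℤ × ℤ →+ ℤ)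
    (hℓ : ∀ N : ℤ, ∃ t, N ≤ ℓ t) {v : ℤ × ℤ} (hv : ℓ v = 0)
    (hker : ∀ x, ℓ x = 0 → ∃ i : ℤ, x = i • v)
    (hdet : ∀ e ∈ Z, ∀ e' ∈ Z, EqOn e e' {x | ℓ x < 0} → e = e') {p : ℕ} (hp : 0 < p)
    (hper : ∀ e ∈ Z, ∀ e' ∈ Z, EqOn e e' {x | 0 < ℓ x} → PeriodicDiff ((p : ℤ) • v) e e') :
    ∀ e ∈ Z, ∀ e' ∈ Z, EqOn e e' {x | 0 < ℓ x} → e = e' := by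
  have hZ := hmin.prop.1
  obtain ⟨B, k, hBk, hB⟩ := exists_block_of_deterministic hZ hc ℓ hv hker hdet hp
  set w := (p : ℤ) • v
  let ρ : Config → (B → ℤ) := fun e x => e x
  have hρ : Continuous ρ := continuous_pi fun x => continuous_apply (x : ℤ × ℤ)
  -- The fibre of `e`; the sets `ρ '' F e` are the quantities to be counted.
  let F : Config → Set Config := fun e => {e' ∈ Z | PeriodicDiff w e e'}
  have hfin : (Set.univ.pi fun _ : B => Icc (-M) M).Finite := Set.Finite.pi fun _ => finite_Icc _ _
  have hsubP : ∀ e, ρ '' F e ⊆ Set.univ.pi fun _ : B => Icc (-M) M := by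
    rintro e _ ⟨e', he', rfl⟩ x -
    exact abs_le.1 (hM e' he'.1 x)
  have hFtr : ∀ t e, F (translate t e) = translate t '' F e := by
    intro t e
    ext z
    constructor
    · rintro ⟨hz, hez⟩
      have hback : ∀ z, translate (-t) (translate t z) = z := fun z => by
        rw [translate_translate]; funext n; simp [translate]
      refine ⟨translate (-t) z, ⟨hZ.translate_mem _ z hz, ?_⟩, ?_⟩
      · have := hez.translate (-t)
        rwa [hback] at this
      · rw [translate_translate]; funext n; simp [translate]
    · rintro ⟨z, ⟨hz, hez⟩, rfl⟩
      exact ⟨hZ.translate_mem t z hz, hez.translate t⟩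
  -- far down, blocks separate finitely many elements of a fibre
  have hsep : ∀ e, ∀ S : Set Config, S.Finite → S ⊆ F e → ∃ N : ℤ, ∀ t, N ≤ ℓ t →
      InjOn (fun z => ρ (translate t z)) S := by
    intro e S hS hSF
    have hpair : ∀ a ∈ S, ∀ b ∈ S, ∃ N : ℤ, ∀ t, N ≤ ℓ t →
        ρ (translate t a) = ρ (translate t b) → a = b := by
      intro a ha b hb
      by_cases hab : a = b
      · exact ⟨0, fun _ _ _ => hab⟩
      obtain ⟨x, hx⟩ := Function.ne_iff.1 hab
      refine ⟨-k - ℓ x, fun t ht h => absurd ?_ hx⟩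
      have h2 := hB _ (hZ.translate_mem t a (hSF ha).1) _ (hZ.translate_mem t b (hSF hb).1)
        (((hSF ha).2.symm.trans (hSF hb).2).translate t)
        (fun y hy => congrFun h ⟨y, hy⟩) (x + t) (by simp; omega)
      simpa [translate] using h2
    choose! N hN using hpair
    obtain ⟨K, hK⟩ := ((hS.prod hS).image fun z : Config × Config => N z.1 z.2).bddAbove
    exact ⟨K, fun t ht a ha b hb h => hN a ha b hb t
      ((hK ⟨(a, b), ⟨ha, hb⟩, rfl⟩).trans ht) h⟩
  have himg : ∀ t e, ρ '' F (translate t e) = (fun z => ρ (translate t z)) '' F e := fun t e => by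
    rw [hFtr, image_image]
  have hFfin : ∀ e, (F e).Finite := by
    -- An infinite fibre would contain more configurations than there are blocks, yet far down their
    -- blocks would be distinct.
    intro e
    by_contra hinf
    obtain ⟨S, hSF, hS⟩ := Set.Infinite.exists_subset_card_eq hinf (hfin.toFinset.card + 1)
    obtain ⟨N, hN⟩ := hsep e S S.finite_toSet hSF
    obtain ⟨t, ht⟩ := hℓ N
    have hle : (S.image fun z => ρ (translate t z)).card ≤ hfin.toFinset.card := by
      refine Finset.card_le_card fun y hy => ?_
      obtain ⟨z, hz, rfl⟩ := Finset.mem_image.1 hy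
      rw [Set.Finite.mem_toFinset]
      refine hsubP (translate t e) ?_
      rw [himg]
      exact ⟨z, hSF hz, rfl⟩
    rw [Finset.card_image_of_injOn (hN t ht)] at hle
    omega
  -- Upper semicontinuity: the pairs in `Z × Z` with periodic difference whose second block is
  -- missing from `ρ '' F e` form a compact set, so its projection is closed, and it avoids `e`.
  have husc : ∀ e ∈ Z, ∃ O, IsOpen O ∧ e ∈ O ∧ ∀ z ∈ O, z ∈ Z → ρ '' F z ⊆ ρ '' F e := by
    intro e he
    have hcl : IsClosed ({z : Config × Config | PeriodicDiff w z.1 z.2} ∩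
        (fun z => ρ z.2) ⁻¹' (ρ '' F e)ᶜ) := by
      refine IsClosed.inter ?_ ((isClosed_discrete _).preimage (hρ.comp continuous_snd))
      simp only [PeriodicDiff, ofPred_forall]
      exact isClosed_iInter fun x => isClosed_eq (by fun_prop) (by fun_prop)
    have hC := (((hc.prod hc).inter_right hcl).image continuous_fst).isClosed
    refine ⟨_, hC.isOpen_compl, ?_, ?_⟩
    · rintro ⟨⟨a, b⟩, ⟨⟨ha, hb⟩, hab, hn⟩, rfl⟩
      exact hn ⟨b, ⟨hb, hab⟩, rfl⟩
    · rintro z hz hzZ _ ⟨z', hz', rfl⟩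
      by_contra hn
      exact hz ⟨(z, z'), ⟨⟨hzZ, hz'.1⟩, hz'.2, hn⟩, rfl⟩
  intro e he e' he' heq
  by_contra hne
  obtain ⟨N, hN⟩ := hsep e (F e) (hFfin e) Subset.rfl
  -- The block reaches down to `-k`, so this shift moves it entirely into `0 < ℓ`.
  obtain ⟨t, ht⟩ := hℓ (k + 1)
  have hcoll : ρ (translate (-t) e) = ρ (translate (-t) e') := by
    funext x
    have := hBk x x.2
    exact heq (by simp; omega)
  obtain ⟨O, hO, heO, hOsub⟩ := husc _ (hZ.translate_mem (-t) e he)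
  obtain ⟨s, hs, hsO⟩ := exists_translate_mem_of_minimal hc hmin ℓ hℓ he hO
    ⟨_, heO, hZ.translate_mem (-t) e he⟩ N
  have hsub := hOsub _ hsO (hZ.translate_mem s e he)
  rw [himg, himg] at hsub
  -- The block count at `s` is the full `(F e).ncard` and is at most the count at `-t`. So the
  -- blocks at `-t` separate `F e` too, against `hcoll`.
  have h1 := ncard_le_ncard hsub ((hFfin e).image _)
  rw [(hN s hs).ncard_image] at h1
  have hinj := injOn_of_ncard_image_eq (le_antisymm (ncard_image_le (hFfin e)) h1) (hFfin e)
  exact hne (hinj ⟨he, fun x => by simp⟩ ⟨he', hper e he e' he' heq⟩ hcoll)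

end Config

/-! ### Lattice geometry and conclusion. -/

/-- The lattice points orthogonal to `u ≠ 0` are the multiples of one of them. -/
theorem exists_generator_of_latticeInner_eq_zero {u : ℤ × ℤ} (hu : u ≠ 0) :
    ∃ v : ℤ × ℤ, latticeInner v u = 0 ∧ ∀ x, latticeInner x u = 0 → ∃ i : ℤ, x = i • v := by
  obtain ⟨a, b⟩ := u
  have hg : 0 < Int.gcd a b := by
    rw [Int.gcd_pos_iff]
    by_contra! h
    exact hu (by simp [h.1, h.2])
  obtain ⟨a', b', hcop, ha, hb⟩ := Int.exists_gcd_one hg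
  set g := Int.gcd a b
  have hg' : (g : ℤ) ≠ 0 := by exact_mod_cast hg.ne'
  refine ⟨(-b', a'), by simp only [latticeInner]; rw [ha, hb]; ring, ?_⟩
  rintro ⟨x, y⟩ h
  simp only [latticeInner] at h
  have h' : x * a' + y * b' = 0 := by
    have : (x * a' + y * b') * (g : ℤ) = 0 := by linear_combination h - x * ha - y * hb
    exact (mul_eq_zero.1 this).resolve_right hg'
  have hbez := Int.gcd_eq_gcd_ab a' b'
  rw [hcop] at hbez
  push_cast at hbez
  -- The multiplier is the pairing of `(x, y)` with the Bézout vector, which pairs to `1` with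
  -- `(-b', a')`.
  refine ⟨y * Int.gcdA a' b' - x * Int.gcdB a' b', ?_⟩
  ext
  · simp only [Prod.smul_mk, smul_eq_mul]
    linear_combination x * hbez + Int.gcdA a' b' * h'
  · simp only [Prod.smul_mk, smul_eq_mul]
    linear_combination y * hbez + Int.gcdB a' b' * h'

theorem proposition3 (c : Config) (hc : c.IsFinitary) (hann : c.HasNontrivialAnnihilator)
    (u : ℤ × ℤ) (hu : u ≠ 0) (hdet : IsOneSidedDeterministic c.orbitClosure u) :
    ∃ d ∈ c.orbitClosure, IsTwoSidedDeterministic d.orbitClosure u := by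
  obtain ⟨f, hfc, hf⟩ := hann
  obtain ⟨v, hv, hker⟩ := exists_generator_of_latticeInner_eq_zero hu
  let ℓ : ℤ × ℤ →+ ℤ := AddMonoidHom.mk' (latticeInner · u) fun x y => by
    simp only [latticeInner, Prod.fst_add, Prod.snd_add]; ring
  have hℓ : ∀ N : ℤ, ∃ t, N ≤ ℓ t := by
    have hpos : 0 < ℓ u := by
      change 0 < u.1 * u.1 + u.2 * u.2
      rcases eq_or_ne u.1 0 with h1 | h1
      · have h2 : u.2 ≠ 0 := fun h2 => hu (Prod.ext h1 h2)
        nlinarith [mul_self_pos.2 h2, mul_self_nonneg u.1]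
      · nlinarith [mul_self_pos.2 h1, mul_self_nonneg u.2]
    intro N
    refine ⟨|N| • u, ?_⟩
    rw [map_zsmul, smul_eq_mul]
    nlinarith [le_abs_self N, abs_nonneg N]
  obtain ⟨M, hM⟩ : ∃ M : ℤ, ∀ x, |c x| ≤ M := by
    obtain ⟨M, hM⟩ := (hc.image abs).bddAbove
    exact ⟨M, fun x => hM ⟨c x, ⟨x, rfl⟩, rfl⟩⟩
  have hX := Config.isSubshift_orbitClosure c
  have hXM : ∀ e ∈ c.orbitClosure, ∀ x, |e x| ≤ M := by
    intro e he x
    refine closure_minimal (t := {e : Config | |e x| ≤ M}) ?_ ?_ he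
    · rintro _ ⟨t, rfl⟩
      exact hM _
    · exact isClosed_le (continuous_apply x).abs continuous_const
  have hXf : ∀ e ∈ c.orbitClosure, Config.formalMul f e = 0 := by
    intro e he
    refine closure_minimal (t := {e : Config | Config.formalMul f e = 0}) ?_ ?_ he
    · rintro _ ⟨t, rfl⟩
      funext n
      have h := congrFun hfc (n - t)
      simp only [Config.formalMul, Config.translate, Pi.zero_apply] at h ⊢
      rw [← h]
      exact Finset.sum_congr rfl fun a _ => by rw [sub_right_comm]
    · refine isClosed_eq ?_ continuous_const
      exact continuous_pi fun n => continuous_finsetSum _ fun a _ =>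
        continuous_const.mul (continuous_apply _)
  have hXc : IsCompact c.orbitClosure :=
    (isCompact_univ_pi fun _ : ℤ × ℤ => (finite_Icc (-M) M).isCompact).of_isClosed_subset
      hX.isClosed fun e he x _ => abs_le.1 (hXM e he x)
  -- The bound `2 * M` is for differences of two configurations bounded by `M`.
  obtain ⟨p, hp, hper⟩ := exists_period_of_vanish ℓ hv hker hf (2 * M)
  obtain ⟨Z, hZX, hmin⟩ := hX.exists_minimal hXc ⟨c, c.mem_orbitClosure_self⟩
  have hZc := hXc.of_isClosed_subset hmin.prop.1.isClosed hZX
  have hdown := Config.eq_of_eqOn_of_minimal hZc hmin (fun e he => hXM e (hZX he)) ℓ hℓ hv hker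
    (fun e he e' he' h => hdet.1 e (hZX he) e' (hZX he') h) hp (by
      intro e he e' he' h
      have hδ := hper (e - e')
        (fun x => (abs_sub _ _).trans (by linarith [hXM e (hZX he) x, hXM e' (hZX he') x]))
        (by
          funext n
          have h1 := congrFun (hXf e (hZX he)) n
          have h2 := congrFun (hXf e' (hZX he')) n
          simp only [Config.formalMul, Pi.zero_apply] at h1 h2
          simp [Config.formalMul, mul_sub, h1, h2])
        (fun x hx => sub_eq_zero.2 (h hx))
      exact fun x => hδ x)
  obtain ⟨d, hd⟩ := hmin.prop.2
  have hdZ := hmin.prop.1.orbitClosure_subset hd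
  refine ⟨d, hZX hd, fun e he e' he' h => hdet.1 e (hZX (hdZ he)) e' (hZX (hdZ he')) h,
    fun e he e' he' h => hdown e (hdZ he) e' (hdZ he') fun x hx => h ?_⟩
  have hx' : 0 < x.1 * u.1 + x.2 * u.2 := hx
  simp only [discreteHalfPlane, latticeInner, mem_ofPred_eq, Prod.fst_neg, Prod.snd_neg]
  linarith
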